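/- Let $n \ge 2$, let $\Omega \subset \mathbb{R}^n$ be open, let $F \in W^{1,n}_{\mathrm{loc}}(\Omega;\mathbb{R}^n)$ (in particular, $F \in W^{1,n}(\Omega;\mathbb{R}^n)$ is allowed), with weak differential matrix $DF = (\partial F^i/\partial x_j)_{i,j}$ and Jacobian determinant $J_F = \det DF$. Let $\operatorname{adj}(DF)$ be the adjugate matrix, so that $DF\cdot\operatorname{adj}(DF) = J_F\, I_n$. Let $V:\mathbb{R}^n\to\mathbb{R}^n$ be a $C^1$ vector field whose derivative $DV$ is bounded on $\mathbb{R}^n$. Then $$\operatorname{div}\big(\operatorname{adj}(DF)\,(V\circ F)\big) = \big((\operatorname{div} V)\circ F\big)\, J_F$$ in $\Omega$ in the sense of distributions; that is, $\operatorname{adj}(DF)(V\circ F)$ and $((\operatorname{div}V)\circ F)J_F$ are locally integrable in $\Omega$, and for every $\varphi\in C_c^\infty(\Omega)$ $$\int_\Omega \big\langle \operatorname{adj}(DF(x))\,V(F(x)),\,\nabla\varphi(x)\big\rangle\,dx = -\int_\Omega (\operatorname{div}V)(F(x))\,J_F(x)\,\varphi(x)\,dx .$$ -/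

import Mathlib

open MeasureTheory TopologicalSpace
open scoped Distributions ENNReal

namespace Piola

/-- Euclidean space `ℝⁿ`. -/
abbrev Euc (n : ℕ) : Type := EuclideanSpace ℝ (Fin n)

/-- The `j`-th partial derivative `∂φ/∂xⱼ (x)` of a real function on `ℝⁿ`. -/
noncomputable def partialDeriv {n : ℕ} (j : Fin n) (φ : Euc n → ℝ) (x : Euc n) : ℝ :=
  fderiv ℝ φ x (EuclideanSpace.single j 1)

/-- The classical divergence `∑ᵢ ∂Vⁱ/∂yᵢ (y)` of a vector field on `ℝⁿ`. -/
noncomputable def divergence {n : ℕ} (V : Euc n → Euc n) (y : Euc n) : ℝ :=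
  ∑ i, partialDeriv i (fun z => V z i) y

/-- `f ∈ L^p_loc(Ω)`: `f` is in `L^p(K)` for every compact `K ⊆ Ω`. -/
def MemLpLoc {n : ℕ} {G : Type*} [NormedAddCommGroup G]
    (Ω : Opens (Euc n)) (p : ℝ≥0∞) (f : Euc n → G) : Prop :=
  ∀ K : Set (Euc n), IsCompact K → K ⊆ (Ω : Set (Euc n)) → MemLp f p (volume.restrict K)

/-- `g` is the weak `j`-th partial derivative of the scalar function `u` in `Ω`: both are locally
integrable in `Ω`, and `∫_Ω u ∂φ/∂xⱼ = - ∫_Ω g φ` for every `φ ∈ C_c^∞(Ω)`. -/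
def IsWeakPartialDeriv {n : ℕ} (Ω : Opens (Euc n)) (j : Fin n) (u g : Euc n → ℝ) : Prop :=
  LocallyIntegrableOn u (Ω : Set (Euc n)) ∧ LocallyIntegrableOn g (Ω : Set (Euc n)) ∧
    ∀ φ : 𝓓(Ω, ℝ), ∫ x in Ω, u x * partialDeriv j φ x = - ∫ x in Ω, g x * φ x

/-- `DF` is (a representative of) the weak differential matrix of `F` in `Ω`, with entries
`(DF)ᵢⱼ = ∂Fⁱ/∂xⱼ`. -/
def IsWeakJacobian {n : ℕ} (Ω : Opens (Euc n)) (F : Euc n → Euc n)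
    (DF : Euc n → Matrix (Fin n) (Fin n) ℝ) : Prop :=
  ∀ i j, IsWeakPartialDeriv Ω j (fun x => F x i) (fun x => DF x i j)

/-- The local Sobolev space `W^{1,p}_loc(Ω; ℝⁿ)` of maps: `F` is in `L^p_loc(Ω)` and has weak first
partial derivatives in `L^p_loc(Ω)`. Values of `F` outside `Ω` play no role. -/
def MemW1pLoc {n : ℕ} (Ω : Opens (Euc n)) (p : ℝ≥0∞) (F : Euc n → Euc n) : Prop :=
  MemLpLoc Ω p F ∧ ∃ DF : Euc n → Matrix (Fin n) (Fin n) ℝ,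
    IsWeakJacobian Ω F DF ∧ ∀ i j, MemLpLoc Ω p (fun x => DF x i j)

/-- `div W = g` in `Ω` in the sense of distributions: `W` and `g` are locally integrable in `Ω` (so
that they define distributions), and `∫_Ω ∑ⱼ Wʲ ∂φ/∂xⱼ = - ∫_Ω g φ` for every `φ ∈ C_c^∞(Ω)`. -/
def DistribDivEq {n : ℕ} (Ω : Opens (Euc n)) (W : Euc n → Euc n) (g : Euc n → ℝ) : Prop :=
  LocallyIntegrableOn W (Ω : Set (Euc n)) ∧ LocallyIntegrableOn g (Ω : Set (Euc n)) ∧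
    ∀ φ : 𝓓(Ω, ℝ), ∫ x in Ω, ∑ j, W x j * partialDeriv j φ x = - ∫ x in Ω, g x * φ x

end Piola

/-!
Write the `j`-th component of `adj(DF) (V ∘ F)` by Cramer's rule as `det DF` with its `j`-th column
replaced by `V ∘ F`. If `F` is of class `C²`, the product rule expresses the divergence as a sum of
determinants. Those containing a second derivative `∂ⱼ∂ₖF` cancel in pairs, since the second
derivatives are symmetric and the determinant is alternating, and the remaining ones add up to
`tr(DV) det DF`.

For a Sobolev map `F`, mollify: weak derivatives commute with mollification, so the jet of the
mollification of `F` is the mollification `ρ ⋆ U` of the jet `U = (F, DF)`. Both sides of the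
identity are continuous functions of the jet growing at most like its `n`-th power. By Jensen's
inequality the integrands for `ρ ⋆ U` are therefore dominated by multiples of `1 + ρ ⋆ ‖U‖ⁿ`, whose
integrals converge because `‖U‖ⁿ` is locally integrable. The generalized dominated convergence
theorem, in which the dominating functions may vary, then gives the limit.
-/

namespace Piola

open Filter Topology Convolution ContinuousLinearMap

theorem sum_offDiag_map_update_update_eq_zero {R M N ι : Type*} [Semiring R] [AddCommMonoid M]
    [Module R M] [AddCommGroup N] [Module R N] [Fintype ι] [DecidableEq ι] (ω : M [⋀^ι]→ₗ[R] N)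
    (v : ι → M) (w : M) {H : ι → ι → M} (hH : ∀ i j, H i j = H j i) :
    ∑ p ∈ Finset.univ.offDiag,
      ω (Function.update (Function.update v p.1 w) p.2 (H p.1 p.2)) = 0 := by
  have hswap : ∀ i j, i ≠ j →
      Function.update (Function.update v i w) j (H i j) ∘ Equiv.swap i j =
        Function.update (Function.update v j w) i (H j i) := by
    intro i j hij
    funext k
    by_cases hi : k = i
    · simp [hi, hH]
    by_cases hj : k = j
    · simp [hj, hij, hij.symm]
    · simp [Equiv.swap_apply_of_ne_of_ne hi hj, hi, hj]
  refine Finset.sum_involution (fun p _ => p.swap) (fun p hp => ?_) (fun p hp _ h => ?_)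
    (fun p hp => ?_) (fun p _ => p.swap_swap)
  all_goals have hne : p.1 ≠ p.2 := (Finset.mem_offDiag.1 hp).2.2
  · rw [Prod.fst_swap, Prod.snd_swap, ← hswap _ _ hne]
    exact ω.map_add_swap _ hne
  · exact hne (congrArg Prod.snd h)
  · simpa using hne.symm

theorem sum_sum_map_update_update {R M N ι : Type*} [Semiring R] [AddCommMonoid M]
    [Module R M] [AddCommGroup N] [Module R N] [Fintype ι] [DecidableEq ι] (ω : M [⋀^ι]→ₗ[R] N)
    (v : ι → M) (w : M) (u : ι → M) {H : ι → ι → M} (hH : ∀ i j, H i j = H j i) :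
    ∑ i, ∑ j, ω (Function.update (Function.update v i w) j (Function.update (H i) i (u i) j)) =
      ∑ i, ω (Function.update v i (u i)) := by
  rw [← Finset.sum_product', ← Finset.diag_union_offDiag,
    Finset.sum_union (Finset.disjoint_diag_offDiag _), Finset.sum_diag]
  have hoff : ∑ p ∈ Finset.univ.offDiag, ω (Function.update (Function.update v p.1 w) p.2
      (Function.update (H p.1) p.1 (u p.1) p.2)) = 0 := by
    rw [← sum_offDiag_map_update_update_eq_zero ω v w hH]
    refine Finset.sum_congr rfl fun p hp => ?_
    rw [Function.update_of_ne (Finset.mem_offDiag.1 hp).2.2.symm]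
  simp [hoff]

theorem sum_fderiv_alternating_update {𝕜 X E F ι : Type*} [NontriviallyNormedField 𝕜]
    [NormedAddCommGroup X] [NormedSpace 𝕜 X] [NormedAddCommGroup E] [NormedSpace 𝕜 E]
    [NormedAddCommGroup F] [NormedSpace 𝕜 F] [Fintype ι] [DecidableEq ι] (ω : E [⋀^ι]→L[𝕜] F)
    (e : ι → X) {G v : X → E} {x : X} (hG : DifferentiableAt 𝕜 (fderiv 𝕜 G) x)
    (hG_symm : IsSymmSndFDerivAt 𝕜 G x) (hv : DifferentiableAt 𝕜 v x) :
    ∑ j, fderiv 𝕜 (fun y => ω (Function.update (fun k => fderiv 𝕜 G y (e k)) j (v y))) x (e j) =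
      ∑ j, ω (Function.update (fun k => fderiv 𝕜 G x (e k)) j (fderiv 𝕜 v x (e j))) := by
  have hcol : ∀ k, HasFDerivAt (fun y => fderiv 𝕜 G y (e k))
      ((fderiv 𝕜 (fderiv 𝕜 G) x).flip (e k)) x := fun k => by
    simpa using! hG.hasFDerivAt.clm_apply (hasFDerivAt_const (e k) x)
  have hdiff : ∀ j k, DifferentiableAt 𝕜
      (fun y => Function.update (fun k => fderiv 𝕜 G y (e k)) j (v y) k) x := by
    intro j k
    obtain rfl | hk := eq_or_ne k j
    · simpa using hv
    · simpa [Function.update_of_ne hk] using (hcol k).differentiableAt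
  have hderiv : ∀ j k,
      fderiv 𝕜 (fun y => Function.update (fun k => fderiv 𝕜 G y (e k)) j (v y) k) x (e j) =
        Function.update (fun k => fderiv 𝕜 (fderiv 𝕜 G) x (e j) (e k)) j
          (fderiv 𝕜 v x (e j)) k := by
    intro j k
    obtain rfl | hk := eq_or_ne k j
    · simp
    · simp [Function.update_of_ne hk, (hcol k).fderiv]
  have hleibniz : ∀ j,
      fderiv 𝕜 (fun y => ω (Function.update (fun k => fderiv 𝕜 G y (e k)) j (v y))) x (e j) =
        ∑ k, ω (Function.update (Function.update (fun k => fderiv 𝕜 G x (e k)) j (v x)) k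
          (Function.update (fun k => fderiv 𝕜 (fderiv 𝕜 G) x (e j) (e k)) j
            (fderiv 𝕜 v x (e j)) k)) := by
    intro j
    have h := fderiv_continuousAlternatingMap_apply_apply (differentiableAt_const ω) (hdiff j) (e j)
    simpa [hderiv] using h
  simp only [hleibniz]
  exact sum_sum_map_update_update ω.toAlternatingMap _ _ _ fun j k => hG_symm.eq _ _

theorem sum_det_updateCol_mul_col {ι R : Type*} [Fintype ι] [DecidableEq ι] [CommRing R]
    (A B : Matrix ι ι R) : ∑ j, (A.updateCol j ((B * A).col j)).det = B.trace * A.det := by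
  have hcol : ∀ j, (A.updateCol j ((B * A).col j)).det = (A.adjugate * (B * A)) j j := fun j => by
    rw [← Matrix.cramer_apply, Matrix.cramer_eq_adjugate_mulVec]
    rfl
  calc ∑ j, (A.updateCol j ((B * A).col j)).det
      = (A.adjugate * (B * A)).trace := Finset.sum_congr rfl fun j _ => hcol j
    _ = (B * (A * A.adjugate)).trace := by rw [Matrix.trace_mul_comm, Matrix.mul_assoc]
    _ = B.trace * A.det := by simp [Matrix.mul_adjugate, mul_comm]

theorem sum_basis_det_update_map {R M ι : Type*} [CommRing R] [AddCommGroup M] [Module R M]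
    [Fintype ι] [DecidableEq ι] (b : Module.Basis ι R M) (f : M →ₗ[R] M) (v : ι → M) :
    ∑ j, b.det (Function.update v j (f (v j))) = LinearMap.trace R M f * b.det v := by
  have hcol : ∀ j, b.repr (f (v j)) = (LinearMap.toMatrix b b f * b.toMatrix v).col j := fun j =>
    (LinearMap.toMatrix_mulVec_repr b b f (v j)).symm
  simp only [Module.Basis.det_apply, Module.Basis.toMatrix_update, hcol]
  rw [sum_det_updateCol_mul_col, LinearMap.trace_eq_matrix_trace R b]

variable {n : ℕ}

theorem partialDeriv_apply {G : Euc n → Euc n} {x : Euc n} (hG : DifferentiableAt ℝ G x)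
    (i j : Fin n) :
    partialDeriv j (fun z => G z i) x = fderiv ℝ G x (EuclideanSpace.single j 1) i := by
  have h := (EuclideanSpace.proj (𝕜 := ℝ) i : Euc n →L[ℝ] ℝ).hasFDerivAt.comp x hG.hasFDerivAt
  exact DFunLike.congr_fun h.fderiv _

/-- The trace, as a continuous linear functional on the endomorphisms of `ℝⁿ`. -/
noncomputable def traceCLM (n : ℕ) : (Euc n →L[ℝ] Euc n) →L[ℝ] ℝ :=
  (LinearMap.trace ℝ (Euc n) ∘ₗ ContinuousLinearMap.coeLM ℝ).toContinuousLinearMap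

theorem divergence_eq_traceCLM {V : Euc n → Euc n} {y : Euc n} (hV : DifferentiableAt ℝ V y) :
    divergence V y = traceCLM n (fderiv ℝ V y) := by
  change _ = LinearMap.trace ℝ (Euc n) (fderiv ℝ V y)
  rw [LinearMap.trace_eq_matrix_trace ℝ (EuclideanSpace.basisFun (Fin n) ℝ).toBasis]
  exact Finset.sum_congr rfl fun i _ => by
    simp [partialDeriv_apply hV, LinearMap.toMatrix_apply]

theorem continuous_divergence {V : Euc n → Euc n} (hV : ContDiff ℝ 1 V) :
    Continuous (divergence V) := by
  have hdiff : Differentiable ℝ V := hV.differentiable one_ne_zero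
  simp only [funext fun y => divergence_eq_traceCLM (hdiff y)]
  exact (traceCLM n).continuous.comp (hV.continuous_fderiv one_ne_zero)

theorem exists_abs_divergence_le {V : Euc n → Euc n} (hV : Differentiable ℝ V)
    (hV' : ∃ C : ℝ, ∀ y, ‖fderiv ℝ V y‖ ≤ C) : ∃ C : ℝ, ∀ y, |divergence V y| ≤ C := by
  obtain ⟨C, hC⟩ := hV'
  refine ⟨‖traceCLM n‖ * C, fun y => ?_⟩
  rw [divergence_eq_traceCLM (hV y)]
  exact (traceCLM n).le_of_opNorm_le_of_le le_rfl (hC y)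

theorem exists_norm_le_one_add_norm {E F : Type*} [NormedAddCommGroup E] [NormedSpace ℝ E]
    [NormedAddCommGroup F] [NormedSpace ℝ F] {V : E → F} (hV : Differentiable ℝ V)
    (hV' : ∃ C : ℝ, ∀ y, ‖fderiv ℝ V y‖ ≤ C) : ∃ C : ℝ, ∀ y, ‖V y‖ ≤ C * (1 + ‖y‖) := by
  obtain ⟨C, hC⟩ := hV'
  have hC₀ : 0 ≤ C := (norm_nonneg _).trans (hC 0)
  refine ⟨‖V 0‖ + C, fun y => ?_⟩
  have hmean : ‖V y - V 0‖ ≤ C * ‖y - 0‖ :=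
    convex_univ.norm_image_sub_le_of_norm_fderiv_le (fun x _ => hV x) (fun x _ => hC x)
      (Set.mem_univ 0) (Set.mem_univ y)
  calc ‖V y‖ ≤ ‖V 0‖ + ‖V y - V 0‖ := norm_le_norm_add_norm_sub' _ _
    _ ≤ ‖V 0‖ + C * ‖y‖ := by simpa using hmean
    _ ≤ (‖V 0‖ + C) * (1 + ‖y‖) := by nlinarith [mul_nonneg (norm_nonneg (V 0)) (norm_nonneg y)]

/-- The determinant of the matrix with given columns, as a continuous alternating form. -/
noncomputable def detForm (n : ℕ) : Euc n [⋀^Fin n]→L[ℝ] ℝ where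
  toAlternatingMap := (EuclideanSpace.basisFun (Fin n) ℝ).toBasis.det
  cont := Continuous.matrix_det <| continuous_matrix fun i j =>
    (EuclideanSpace.proj (𝕜 := ℝ) i).continuous.comp (continuous_apply j)

/-- First-order jets of maps `ℝⁿ → ℝⁿ`: the value `p.1` of the map at a point and the columns
`p.2 j` of its differential matrix there, the `j`-th of which is the `j`-th partial derivative. -/
abbrev Jet (n : ℕ) : Type := Euc n × (Fin n → Euc n)

/-- The `j`-th component of `adj(A) V(y)` at the jet `(y, A)`, written by Cramer's rule as the
determinant of `A` with its `j`-th column replaced by `V(y)`. -/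
noncomputable def flux (V : Euc n → Euc n) (j : Fin n) (p : Jet n) : ℝ :=
  detForm n (Function.update p.2 j (V p.1))

/-- The quantity `div V(y) det A` at the jet `(y, A)`. -/
noncomputable def source (V : Euc n → Euc n) (p : Jet n) : ℝ :=
  divergence V p.1 * detForm n p.2

/-- The jet of a map that is differentiable in the classical sense. -/
noncomputable def classicalJet (G : Euc n → Euc n) (x : Euc n) : Jet n :=
  (G x, fun j => fderiv ℝ G x (EuclideanSpace.single j 1))

/-- The jet of `F` with respect to a differential matrix `DF` chosen independently of `F`, for
instance a weak one. -/
def jet (F : Euc n → Euc n) (DF : Euc n → Matrix (Fin n) (Fin n) ℝ) (x : Euc n) : Jet n :=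
  (F x, fun j => WithLp.toLp 2 ((DF x).col j))

theorem flux_jet (V F : Euc n → Euc n) (DF : Euc n → Matrix (Fin n) (Fin n) ℝ) (j : Fin n)
    (x : Euc n) : flux V j (jet F DF x) = (DF x).adjugate.mulVec (V (F x)).ofLp j := by
  rw [← Matrix.cramer_eq_adjugate_mulVec, Matrix.cramer_apply]
  change (EuclideanSpace.basisFun (Fin n) ℝ).toBasis.det _ = _
  rw [Module.Basis.det_apply, Module.Basis.toMatrix_update]
  rfl

theorem source_jet (V F : Euc n → Euc n) (DF : Euc n → Matrix (Fin n) (Fin n) ℝ) (x : Euc n) :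
    source V (jet F DF x) = divergence V (F x) * (DF x).det :=
  rfl

theorem contDiff_flux {V : Euc n → Euc n} {r : WithTop ℕ∞} (hV : ContDiff ℝ r V) (j : Fin n) :
    ContDiff ℝ r (flux V j) := by
  refine (detForm n).toContinuousMultilinearMap.contDiff.comp (contDiff_pi.2 fun k => ?_)
  obtain rfl | hk := eq_or_ne k j
  · simpa [Function.comp_def] using! hV.comp contDiff_fst
  · simpa [Function.update_of_ne hk, Function.comp_def] using!
      (contDiff_apply ℝ (Euc n) k).comp contDiff_snd

theorem continuous_source {V : Euc n → Euc n} (hV : ContDiff ℝ 1 V) : Continuous (source V) :=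
  ((continuous_divergence hV).comp continuous_fst).mul ((detForm n).cont.comp continuous_snd)

theorem exists_abs_flux_le {V : Euc n → Euc n} (hV : ∃ C : ℝ, ∀ y, ‖V y‖ ≤ C * (1 + ‖y‖))
    (j : Fin n) : ∃ C : ℝ, ∀ p : Jet n, |flux V j p| ≤ C * (1 + ‖p‖ ^ n) := by
  obtain ⟨C, hC⟩ := hV
  refine ⟨‖detForm n‖ * (max C 1) ^ n * 2 ^ (n - 1), fun p => ?_⟩
  have hcols : ‖Function.update p.2 j (V p.1)‖ ≤ max C 1 * (1 + ‖p‖) := by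
    refine (pi_norm_le_iff_of_nonneg (by positivity)).2 fun k => ?_
    obtain rfl | hk := eq_or_ne k j
    · rw [Function.update_self]
      exact (hC p.1).trans (by gcongr; exacts [le_max_left C 1, norm_fst_le p])
    · rw [Function.update_of_ne hk]
      calc ‖p.2 k‖ ≤ ‖p‖ := (norm_le_pi_norm p.2 k).trans (norm_snd_le p)
        _ ≤ 1 * (1 + ‖p‖) := by linarith
        _ ≤ max C 1 * (1 + ‖p‖) := by gcongr; exact le_max_right C 1
  calc |flux V j p| ≤ ‖detForm n‖ * (max C 1 * (1 + ‖p‖)) ^ n :=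
        (detForm n).le_opNorm_mul_pow_of_le hcols
    _ = ‖detForm n‖ * max C 1 ^ n * (1 + ‖p‖) ^ n := by rw [mul_pow, ← mul_assoc]
    _ ≤ ‖detForm n‖ * max C 1 ^ n * (2 ^ (n - 1) * (1 ^ n + ‖p‖ ^ n)) := by
        gcongr
        exact add_pow_le zero_le_one (norm_nonneg p) n
    _ = ‖detForm n‖ * max C 1 ^ n * 2 ^ (n - 1) * (1 + ‖p‖ ^ n) := by rw [one_pow]; ring

theorem exists_abs_source_le {V : Euc n → Euc n} (hV : ∃ C : ℝ, ∀ y, |divergence V y| ≤ C) :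
    ∃ C : ℝ, ∀ p : Jet n, |source V p| ≤ C * (1 + ‖p‖ ^ n) := by
  obtain ⟨C, hC⟩ := hV
  have hC₀ : 0 ≤ C := (abs_nonneg _).trans (hC 0)
  refine ⟨C * ‖detForm n‖, fun p => ?_⟩
  calc |source V p| = |divergence V p.1| * |detForm n p.2| := abs_mul _ _
    _ ≤ C * (‖detForm n‖ * ‖p‖ ^ n) := by
        gcongr
        exacts [hC p.1, (detForm n).le_opNorm_mul_pow_of_le (norm_snd_le p)]
    _ ≤ C * (‖detForm n‖ * (1 + ‖p‖ ^ n)) := by gcongr; linarith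
    _ = C * ‖detForm n‖ * (1 + ‖p‖ ^ n) := by ring

theorem sum_partialDeriv_flux_classicalJet {G V : Euc n → Euc n} {x : Euc n}
    (hG : ContDiffAt ℝ 2 G x) (hV : DifferentiableAt ℝ V (G x)) :
    ∑ j, partialDeriv j (fun y => flux V j (classicalJet G y)) x =
      source V (classicalJet G x) := by
  have hG₁ : DifferentiableAt ℝ G x := hG.differentiableAt two_ne_zero
  have hG₂ : DifferentiableAt ℝ (fderiv ℝ G) x :=
    (hG.fderiv_right (m := 1) (by norm_num)).differentiableAt one_ne_zero
  calc ∑ j, partialDeriv j (fun y => flux V j (classicalJet G y)) x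
      = ∑ j, detForm n (Function.update (classicalJet G x).2 j
          (fderiv ℝ (V ∘ G) x (EuclideanSpace.single j 1))) :=
        sum_fderiv_alternating_update (detForm n) (fun j => EuclideanSpace.single j 1) hG₂
          (hG.isSymmSndFDerivAt (by simp)) (hV.comp x hG₁)
    _ = ∑ j, detForm n (Function.update (classicalJet G x).2 j
          (fderiv ℝ V (G x) ((classicalJet G x).2 j))) := by
        rw [fderiv_comp x hV hG₁]
        rfl
    _ = source V (classicalJet G x) := by
        rw [source, classicalJet, divergence_eq_traceCLM hV]
        exact sum_basis_det_update_map (EuclideanSpace.basisFun (Fin n) ℝ).toBasis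
          (fderiv ℝ V (G x)) _

theorem integral_mul_fderiv_eq_neg_of_hasCompactSupport {X : Type*} [NormedAddCommGroup X]
    [NormedSpace ℝ X] [FiniteDimensional ℝ X] [MeasurableSpace X] [BorelSpace X] {μ : Measure X}
    [μ.IsAddHaarMeasure] {f φ : X → ℝ} (hf : ContDiff ℝ 1 f) (hφ : ContDiff ℝ 1 φ)
    (hφc : HasCompactSupport φ) (v : X) :
    ∫ x, f x * fderiv ℝ φ x v ∂μ = -∫ x, fderiv ℝ f x v * φ x ∂μ := by
  have hf' : Continuous fun x => fderiv ℝ f x v :=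
    (hf.continuous_fderiv one_ne_zero).clm_apply continuous_const
  have hφ' : Continuous fun x => fderiv ℝ φ x v :=
    (hφ.continuous_fderiv one_ne_zero).clm_apply continuous_const
  exact integral_mul_fderiv_eq_neg_fderiv_mul_of_integrable
    ((hf'.mul hφ.continuous).integrable_of_hasCompactSupport hφc.mul_left)
    ((hf.continuous.mul hφ').integrable_of_hasCompactSupport (hφc.fderiv_apply ℝ v).mul_left)
    ((hf.continuous.mul hφ.continuous).integrable_of_hasCompactSupport hφc.mul_left)
    (fun x _ => hf.differentiable one_ne_zero x) (fun x _ => hφ.differentiable one_ne_zero x)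

theorem contDiff_classicalJet {G : Euc n → Euc n} {r : WithTop ℕ∞} (hG : ContDiff ℝ (r + 1) G) :
    ContDiff ℝ r (classicalJet G) :=
  (hG.of_le le_self_add).prodMk <| contDiff_pi.2 fun _ =>
    (hG.fderiv_right le_rfl).clm_apply contDiff_const

theorem sum_integral_flux_classicalJet {G V : Euc n → Euc n} (hG : ContDiff ℝ 2 G)
    (hV : ContDiff ℝ 1 V) {φ : Euc n → ℝ} (hφ : ContDiff ℝ 1 φ) (hφc : HasCompactSupport φ) :
    ∑ j, ∫ x, flux V j (classicalJet G x) * partialDeriv j φ x =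
      -∫ x, source V (classicalJet G x) * φ x := by
  have hflux : ∀ j, ContDiff ℝ 1 fun x => flux V j (classicalJet G x) := fun j =>
    (contDiff_flux hV j).comp (contDiff_classicalJet (r := 1) hG)
  have hflux' : ∀ j, Continuous (partialDeriv j fun x => flux V j (classicalJet G x)) := fun j =>
    ((hflux j).continuous_fderiv one_ne_zero).clm_apply continuous_const
  have hint : ∀ j, Integrable fun x =>
      partialDeriv j (fun x => flux V j (classicalJet G x)) x * φ x := fun j =>
    ((hflux' j).mul hφ.continuous).integrable_of_hasCompactSupport hφc.mul_left
  calc ∑ j, ∫ x, flux V j (classicalJet G x) * partialDeriv j φ x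
      = ∑ j, -∫ x, partialDeriv j (fun x => flux V j (classicalJet G x)) x * φ x :=
        Finset.sum_congr rfl fun j _ =>
          integral_mul_fderiv_eq_neg_of_hasCompactSupport (hflux j) hφ hφc _
    _ = -∫ x, ∑ j, partialDeriv j (fun x => flux V j (classicalJet G x)) x * φ x := by
        rw [Finset.sum_neg_distrib, integral_finsetSum _ fun j _ => hint j]
    _ = -∫ x, source V (classicalJet G x) * φ x := by
        simp only [← Finset.sum_mul, sum_partialDeriv_flux_classicalJet hG.contDiffAt
          (hV.differentiable one_ne_zero _)]

theorem tendsto_integral_of_norm_le_of_tendsto_integral {α E : Type*} [MeasurableSpace α]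
    {μ : Measure α} [NormedAddCommGroup E] [NormedSpace ℝ E] {f : ℕ → α → E} {f' : α → E}
    {h : ℕ → α → ℝ} {h' : α → ℝ} (hf : ∀ k, AEStronglyMeasurable (f k) μ)
    (hh : ∀ k, Integrable (h k) μ) (hh' : Integrable h' μ)
    (hfh : ∀ k, ∀ᵐ x ∂μ, ‖f k x‖ ≤ h k x)
    (hf_lim : ∀ᵐ x ∂μ, Tendsto (fun k => f k x) atTop (𝓝 (f' x)))
    (hh_lim : ∀ᵐ x ∂μ, Tendsto (fun k => h k x) atTop (𝓝 (h' x)))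
    (hh_int : Tendsto (fun k => ∫ x, h k x ∂μ) atTop (𝓝 (∫ x, h' x ∂μ))) :
    Tendsto (fun k => ∫ x, f k x ∂μ) atTop (𝓝 (∫ x, f' x ∂μ)) := by
  have hf' : AEStronglyMeasurable f' μ := aestronglyMeasurable_of_tendsto_ae atTop hf hf_lim
  have hfh' : ∀ᵐ x ∂μ, ‖f' x‖ ≤ h' x := by
    filter_upwards [ae_all_iff.2 hfh, hf_lim, hh_lim] with x hx hfx hhx
    exact le_of_tendsto_of_tendsto' hfx.norm hhx hx
  have hfi' : Integrable f' μ := hh'.mono' hf' hfh'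
  have hfi : ∀ k, Integrable (f k) μ := fun k => (hh k).mono' (hf k) (hfh k)
  -- The part of `‖f k - f'‖` exceeding `h k - h'` is dominated by the fixed function `2 * h'`.
  let e : ℕ → α → ℝ := fun k x => max (‖f k x - f' x‖ - (h k x - h' x)) 0
  have he : ∀ k, Integrable (e k) μ := fun k =>
    (((hfi k).sub hfi').norm.sub ((hh k).sub hh')).pos_part
  have he_le : ∀ k, ∀ᵐ x ∂μ, ‖e k x‖ ≤ 2 * h' x := fun k => by
    filter_upwards [hfh k, hfh'] with x hx hx'
    rw [Real.norm_of_nonneg (le_max_right _ _)]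
    refine max_le ?_ (by linarith [norm_nonneg (f' x)])
    linarith [norm_sub_le (f k x) (f' x)]
  have he_lim : ∀ᵐ x ∂μ, Tendsto (fun k => e k x) atTop (𝓝 0) := by
    filter_upwards [hf_lim, hh_lim] with x hfx hhx
    simpa using ((hfx.sub_const (f' x)).norm.sub (hhx.sub_const (h' x))).max
      (tendsto_const_nhds (x := (0 : ℝ)))
  have he_int : Tendsto (fun k => ∫ x, e k x ∂μ) atTop (𝓝 0) := by
    simpa using tendsto_integral_of_dominated_convergence _ (fun k => (he k).aestronglyMeasurable)
      (hh'.const_mul 2) he_le he_lim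
  have hbound : ∀ k, ‖∫ x, f k x ∂μ - ∫ x, f' x ∂μ‖ ≤
      ∫ x, e k x ∂μ + (∫ x, h k x ∂μ - ∫ x, h' x ∂μ) := fun k => by
    rw [← integral_sub (hfi k) hfi', ← integral_sub' (hh k) hh',
      ← integral_add' (he k) ((hh k).sub hh')]
    refine norm_integral_le_of_norm_le ((he k).add ((hh k).sub hh')) (.of_forall fun x => ?_)
    exact sub_le_iff_le_add.1 (le_max_left _ _)
  refine tendsto_iff_norm_sub_tendsto_zero.2 (squeeze_zero (fun _ => norm_nonneg _) hbound ?_)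
  simpa using he_int.add (hh_int.sub_const (∫ x, h' x ∂μ))

section Mollification

variable {X : Type*} [NormedAddCommGroup X] [MeasurableSpace X] {μ : Measure X}
  {E F : Type*} [NormedAddCommGroup E] [NormedSpace ℝ E] [NormedAddCommGroup F] [NormedSpace ℝ F]

theorem map_convolution_lsmul [CompleteSpace E] [CompleteSpace F] (T : E →L[ℝ] F) {f : X → ℝ}
    {U : X → E} {x : X} (h : ConvolutionExistsAt f U x (lsmul ℝ ℝ) μ) :
    T ((f ⋆[lsmul ℝ ℝ, μ] U) x) = (f ⋆[lsmul ℝ ℝ, μ] fun y => T (U y)) x := by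
  rw [convolution_def, ← T.integral_comp_comm h.integrable]
  simp only [convolution_def, lsmul_apply, map_smul]

variable [NormedSpace ℝ X] [FiniteDimensional ℝ X] [BorelSpace X]

theorem convolution_normed_eq_integral (ρ : ContDiffBump (0 : X)) (U : X → E) (x : X) :
    (ρ.normed μ ⋆[lsmul ℝ ℝ, μ] U) x =
      ∫ t, U (x - t) ∂μ.withDensity fun t => ENNReal.ofReal (ρ.normed μ t) := by
  rw [integral_withDensity_eq_integral_toReal_smul
    ρ.continuous_normed.measurable.ennreal_ofReal (.of_forall fun _ => ENNReal.ofReal_lt_top),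
    convolution_def]
  simp [ENNReal.toReal_ofReal, ρ.nonneg_normed]

variable [μ.IsAddHaarMeasure]

theorem isProbabilityMeasure_withDensity_normed (ρ : ContDiffBump (0 : X)) :
    IsProbabilityMeasure (μ.withDensity fun t => ENNReal.ofReal (ρ.normed μ t)) := by
  refine ⟨?_⟩
  rw [withDensity_apply _ MeasurableSet.univ, Measure.restrict_univ,
    ← ofReal_integral_eq_lintegral_ofReal ρ.integrable_normed (.of_forall ρ.nonneg_normed),
    ρ.integral_normed, ENNReal.ofReal_one]

theorem convolutionExists_normed (ρ : ContDiffBump (0 : X)) {U : X → E}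
    (hU : LocallyIntegrable U μ) : ConvolutionExists (ρ.normed μ) U (lsmul ℝ ℝ) μ :=
  ρ.hasCompactSupport_normed.convolutionExists_left _ ρ.continuous_normed hU

theorem contDiff_convolution_normed [CompleteSpace E] (ρ : ContDiffBump (0 : X)) {U : X → E}
    (hU : LocallyIntegrable U μ) {r : ℕ∞} : ContDiff ℝ r (ρ.normed μ ⋆[lsmul ℝ ℝ, μ] U) :=
  ρ.hasCompactSupport_normed.contDiff_convolution_left _ ρ.contDiff_normed hU

theorem integrable_withDensity_normed (ρ : ContDiffBump (0 : X)) {U : X → E}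
    (hU : LocallyIntegrable U μ) (x : X) :
    Integrable (fun t => U (x - t)) (μ.withDensity fun t => ENNReal.ofReal (ρ.normed μ t)) := by
  rw [integrable_withDensity_iff_integrable_smul'
    ρ.continuous_normed.measurable.ennreal_ofReal (.of_forall fun _ => ENNReal.ofReal_lt_top)]
  simpa [ENNReal.toReal_ofReal, ρ.nonneg_normed] using (convolutionExists_normed ρ hU x).integrable

theorem integral_convolution_normed [CompleteSpace E] (ρ : ContDiffBump (0 : X)) {U : X → E}
    (hU : Integrable U μ) : ∫ x, (ρ.normed μ ⋆[lsmul ℝ ℝ, μ] U) x ∂μ = ∫ x, U x ∂μ := by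
  rw [integral_convolution (μ := μ) (ν := μ) _ ρ.integrable_normed hU, ρ.integral_normed,
    lsmul_apply, one_smul]

theorem norm_convolution_normed_pow_le [CompleteSpace E] (ρ : ContDiffBump (0 : X)) {U : X → E}
    {m : ℕ} (hU : LocallyIntegrable U μ) (hUm : LocallyIntegrable (fun x => ‖U x‖ ^ m) μ) (x : X) :
    ‖(ρ.normed μ ⋆[lsmul ℝ ℝ, μ] U) x‖ ^ m ≤
      (ρ.normed μ ⋆[lsmul ℝ ℝ, μ] fun y => ‖U y‖ ^ m) x := by
  have := isProbabilityMeasure_withDensity_normed (μ := μ) ρ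
  rw [convolution_normed_eq_integral, convolution_normed_eq_integral]
  exact ((convexOn_univ_norm (E := E)).pow (fun _ _ => norm_nonneg _) m).map_integral_le
    (by fun_prop) isClosed_univ (.of_forall fun _ => Set.mem_univ _)
    (integrable_withDensity_normed ρ hU x) (integrable_withDensity_normed ρ hUm x)

theorem abs_comp_convolution_normed_mul_le [CompleteSpace E] (ρ : ContDiffBump (0 : X)) {Φ : E → ℝ}
    {C : ℝ} {m : ℕ} (hΦ : ∀ p, |Φ p| ≤ C * (1 + ‖p‖ ^ m)) {U : X → E} (hU : LocallyIntegrable U μ)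
    (hUm : LocallyIntegrable (fun x => ‖U x‖ ^ m) μ) {c B : ℝ} (hc : |c| ≤ B) (x : X) :
    |Φ ((ρ.normed μ ⋆[lsmul ℝ ℝ, μ] U) x) * c| ≤
      C * (|c| + B * (ρ.normed μ ⋆[lsmul ℝ ℝ, μ] fun y => ‖U y‖ ^ m) x) := by
  have hC : 0 ≤ C := nonneg_of_mul_nonneg_left ((abs_nonneg _).trans (hΦ 0)) (by positivity)
  have hJensen := norm_convolution_normed_pow_le ρ hU hUm x
  have hB : 0 ≤ B := (abs_nonneg c).trans hc
  calc |Φ ((ρ.normed μ ⋆[lsmul ℝ ℝ, μ] U) x) * c|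
      ≤ C * (1 + ‖(ρ.normed μ ⋆[lsmul ℝ ℝ, μ] U) x‖ ^ m) * |c| := by
        rw [abs_mul]
        gcongr
        exact hΦ _
    _ = C * (|c| + |c| * ‖(ρ.normed μ ⋆[lsmul ℝ ℝ, μ] U) x‖ ^ m) := by ring
    _ ≤ C * (|c| + B * (ρ.normed μ ⋆[lsmul ℝ ℝ, μ] fun y => ‖U y‖ ^ m) x) := by gcongr

theorem tendsto_integral_comp_convolution_normed [CompleteSpace E] {Φ : E → ℝ} (hΦ : Continuous Φ)
    {m : ℕ} (hΦm : ∃ C : ℝ, ∀ p, |Φ p| ≤ C * (1 + ‖p‖ ^ m)) {U : X → E}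
    (hU : LocallyIntegrable U μ) (hUm : Integrable (fun x => ‖U x‖ ^ m) μ) {ψ : X → ℝ}
    (hψ : Integrable ψ μ) (hψb : ∃ B, ∀ x, |ψ x| ≤ B) {ρ : ℕ → ContDiffBump (0 : X)}
    (hρ : Tendsto (fun k => (ρ k).rOut) atTop (𝓝 0)) {a : ℝ}
    (hρa : ∀ k, (ρ k).rOut ≤ a * (ρ k).rIn) :
    Tendsto (fun k => ∫ x, Φ (((ρ k).normed μ ⋆[lsmul ℝ ℝ, μ] U) x) * ψ x ∂μ) atTop
      (𝓝 (∫ x, Φ (U x) * ψ x ∂μ)) := by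
  obtain ⟨C, hC⟩ := hΦm
  obtain ⟨B, hB⟩ := hψb
  have hUρ : ∀ k, Integrable ((ρ k).normed μ ⋆[lsmul ℝ ℝ, μ] fun x => ‖U x‖ ^ m) μ := fun k =>
    (ρ k).integrable_normed.integrable_convolution _ hUm
  refine tendsto_integral_of_norm_le_of_tendsto_integral
    (h := fun k x => C * (|ψ x| + B * ((ρ k).normed μ ⋆[lsmul ℝ ℝ, μ] fun y => ‖U y‖ ^ m) x))
    (h' := fun x => C * (|ψ x| + B * ‖U x‖ ^ m)) (fun k => ?_)
    (fun k => (hψ.abs.add ((hUρ k).const_mul B)).const_mul C)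
    ((hψ.abs.add (hUm.const_mul B)).const_mul C) (fun k => .of_forall fun x =>
      abs_comp_convolution_normed_mul_le (ρ k) hC hU hUm.locallyIntegrable (hB x) x) ?_ ?_ ?_
  · have hcont := (contDiff_convolution_normed (ρ k) hU (r := 0)).continuous
    exact (hΦ.comp hcont).aestronglyMeasurable.mul hψ.aestronglyMeasurable
  · filter_upwards [ContDiffBump.ae_convolution_tendsto_right_of_locallyIntegrable (μ := μ) hρ
      (.of_forall hρa) hU] with x hx
    exact ((hΦ.tendsto _).comp hx).mul_const _
  · filter_upwards [ContDiffBump.ae_convolution_tendsto_right_of_locallyIntegrable (μ := μ) hρ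
      (.of_forall hρa) hUm.locallyIntegrable] with x hx
    exact ((hx.const_mul B).const_add _).const_mul C
  · refine tendsto_const_nhds.congr fun k => ?_
    rw [integral_const_mul, integral_const_mul, integral_add hψ.abs (hUm.const_mul B),
      integral_add hψ.abs ((hUρ k).const_mul B), integral_const_mul, integral_const_mul,
      integral_convolution_normed (ρ k) hUm]

end Mollification

section Convolution

variable {X : Type*} [NormedAddCommGroup X] [NormedSpace ℝ X] [FiniteDimensional ℝ X]
  [MeasurableSpace X] [BorelSpace X] {μ : Measure X} [μ.IsAddHaarMeasure]
  {E : Type*} [NormedAddCommGroup E] [NormedSpace ℝ E]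

theorem fderiv_convolution_lsmul_apply [CompleteSpace E] {f : X → ℝ} (hfc : HasCompactSupport f)
    (hf : ContDiff ℝ 1 f) {U : X → E} (hU : LocallyIntegrable U μ) (x v : X) :
    fderiv ℝ (f ⋆[lsmul ℝ ℝ, μ] U) x v =
      ((fun y => fderiv ℝ f y v) ⋆[lsmul ℝ ℝ, μ] U) x := by
  have hex := (hfc.fderiv (𝕜 := ℝ)).convolutionExists_left
    ((lsmul ℝ ℝ : ℝ →L[ℝ] E →L[ℝ] E).precompL X) (hf.continuous_fderiv one_ne_zero) hU x
  rw [(hfc.hasFDerivAt_convolution_left (lsmul ℝ ℝ) hf hU x).fderiv, convolution_def,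
    ContinuousLinearMap.integral_apply hex.integrable]
  rfl

theorem convolution_lsmul_indicator {f : X → ℝ} {U : X → E} {K Ω : Set X} (hKΩ : K ⊆ Ω)
    (hΩ : MeasurableSet Ω) {x : X} (hf : ∀ y ∉ K, f (x - y) = 0) :
    (f ⋆[lsmul ℝ ℝ, μ] K.indicator U) x = ∫ y in Ω, f (x - y) • U y ∂μ := by
  rw [convolution_eq_swap, ← integral_indicator hΩ]
  congr with y
  by_cases hy : y ∈ K
  · simp [hy, hKΩ hy]
  · by_cases hyΩ : y ∈ Ω <;> simp [hy, hyΩ, hf y hy]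

theorem map_convolution_indicator {F : Type*} [NormedAddCommGroup F] [NormedSpace ℝ F]
    [CompleteSpace E] [CompleteSpace F] (T : E →L[ℝ] F) (ρ : ContDiffBump (0 : X)) {K : Set X}
    {U : X → E} (hU : LocallyIntegrable (K.indicator U) μ) (x : X) :
    T ((ρ.normed μ ⋆[lsmul ℝ ℝ, μ] K.indicator U) x) =
      (ρ.normed μ ⋆[lsmul ℝ ℝ, μ] K.indicator fun y => T (U y)) x := by
  rw [map_convolution_lsmul T (convolutionExists_normed ρ hU x)]
  congr with y
  exact (congrFun (Set.indicator_comp_of_zero (s := K) (f := U) T.map_zero) y).symm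

theorem tsupport_normed_sub_subset (ρ : ContDiffBump (0 : X)) (x : X) :
    tsupport (fun y => ρ.normed μ (x - y)) ⊆ Metric.closedBall x ρ.rOut := fun y hy => by
  have h := tsupport_comp_subset_preimage (ρ.normed μ) (continuous_const.sub continuous_id) hy
  rw [ρ.tsupport_normed_eq] at h
  simpa [dist_eq_norm, norm_sub_rev] using h

end Convolution

theorem tsupport_partialDeriv_subset (j : Fin n) (φ : Euc n → ℝ) :
    tsupport (partialDeriv j φ) ⊆ tsupport φ :=
  tsupport_fderiv_apply_subset ℝ _

theorem partialDeriv_comp_const_sub (j : Fin n) {f : Euc n → ℝ} {x y : Euc n}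
    (hf : DifferentiableAt ℝ f (x - y)) :
    partialDeriv j (fun z => f (x - z)) y = -partialDeriv j f (x - y) := by
  have h := hf.hasFDerivAt.comp y ((hasFDerivAt_id y).const_sub x)
  rw [partialDeriv, show fderiv ℝ (fun z => f (x - z)) y = _ from h.fderiv]
  simp [partialDeriv]

/-- The reflected translate `y ↦ ρ (x - y)` of a normalized bump function, as a test function: its
pairing with a function is the mollification of that function at `x`. -/
noncomputable def mollifierAt {Ω : Opens (Euc n)} (ρ : ContDiffBump (0 : Euc n)) (x : Euc n)
    (hx : Metric.closedBall x ρ.rOut ⊆ (Ω : Set (Euc n))) : 𝓓(Ω, ℝ) :=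
  ⟨fun y => ρ.normed volume (x - y), ρ.contDiff_normed.comp (contDiff_const.sub contDiff_id),
    (isCompact_closedBall x ρ.rOut).of_isClosed_subset (isClosed_tsupport _)
      (tsupport_normed_sub_subset ρ x), (tsupport_normed_sub_subset ρ x).trans hx⟩

theorem mollifierAt_apply {Ω : Opens (Euc n)} (ρ : ContDiffBump (0 : Euc n)) (x : Euc n)
    (hx : Metric.closedBall x ρ.rOut ⊆ (Ω : Set (Euc n))) (y : Euc n) :
    mollifierAt ρ x hx y = ρ.normed volume (x - y) :=
  rfl

theorem partialDeriv_mollifierAt (j : Fin n) {Ω : Opens (Euc n)} (ρ : ContDiffBump (0 : Euc n))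
    (x : Euc n) (hx : Metric.closedBall x ρ.rOut ⊆ (Ω : Set (Euc n))) (y : Euc n) :
    partialDeriv j (mollifierAt ρ x hx) y = -partialDeriv j (ρ.normed volume) (x - y) :=
  partialDeriv_comp_const_sub j (ρ.contDiff_normed.differentiable one_ne_zero _)

theorem IsWeakPartialDeriv.partialDeriv_convolution {Ω : Opens (Euc n)} {j : Fin n}
    {u g : Euc n → ℝ} (h : IsWeakPartialDeriv Ω j u g) {K : Set (Euc n)} (hK : IsCompact K)
    (hKΩ : K ⊆ (Ω : Set (Euc n))) (ρ : ContDiffBump (0 : Euc n)) {x : Euc n}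
    (hx : Metric.closedBall x ρ.rOut ⊆ K) :
    partialDeriv j (ρ.normed volume ⋆[lsmul ℝ ℝ, volume] K.indicator u) x =
      (ρ.normed volume ⋆[lsmul ℝ ℝ, volume] K.indicator g) x := by
  have hu : LocallyIntegrable (K.indicator u) :=
    ((h.1.integrableOn_compact_subset hKΩ hK).integrable_indicator
      hK.measurableSet).locallyIntegrable
  let ψ : 𝓓(Ω, ℝ) := mollifierAt ρ x (hx.trans hKΩ)
  have hψ : tsupport ψ ⊆ K := (tsupport_normed_sub_subset ρ x).trans hx
  have hψK : ∀ y ∉ K, ρ.normed volume (x - y) = 0 := fun y hy =>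
    image_eq_zero_of_notMem_tsupport (f := ψ) fun hy' => hy (hψ hy')
  have hψK' : ∀ y ∉ K, partialDeriv j (ρ.normed volume) (x - y) = 0 := fun y hy => by
    rw [← neg_eq_zero, ← partialDeriv_mollifierAt j ρ x (hx.trans hKΩ)]
    exact image_eq_zero_of_notMem_tsupport fun hy' => hy (hψ (tsupport_partialDeriv_subset j ψ hy'))
  calc partialDeriv j (ρ.normed volume ⋆[lsmul ℝ ℝ, volume] K.indicator u) x
      = (partialDeriv j (ρ.normed volume) ⋆[lsmul ℝ ℝ, volume] K.indicator u) x :=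
        fderiv_convolution_lsmul_apply ρ.hasCompactSupport_normed ρ.contDiff_normed hu x _
    _ = ∫ y in Ω, partialDeriv j (ρ.normed volume) (x - y) • u y :=
        convolution_lsmul_indicator hKΩ Ω.isOpen.measurableSet hψK'
    _ = -∫ y in Ω, u y * partialDeriv j ψ y := by
        simp only [ψ, partialDeriv_mollifierAt, mul_neg, integral_neg, neg_neg, smul_eq_mul,
          mul_comm]
    _ = ∫ y in Ω, g y * ψ y := by rw [h.2.2 ψ, neg_neg]
    _ = ∫ y in Ω, ρ.normed volume (x - y) • g y := by
        simp only [ψ, mollifierAt_apply, smul_eq_mul, mul_comm]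
    _ = (ρ.normed volume ⋆[lsmul ℝ ℝ, volume] K.indicator g) x :=
        (convolution_lsmul_indicator hKΩ Ω.isOpen.measurableSet hψK).symm

theorem integrable_mul_of_tsupport_subset {X : Type*} [TopologicalSpace X] [T2Space X]
    [MeasurableSpace X] [OpensMeasurableSpace X] {μ : Measure X} {Ω : Set X} {w ψ : X → ℝ}
    (hw : LocallyIntegrableOn w Ω μ) (hψ : Continuous ψ) (hψc : HasCompactSupport ψ)
    (hψΩ : tsupport ψ ⊆ Ω) : Integrable (fun x => w x * ψ x) μ := by
  have h : IntegrableOn (fun x => w x * ψ x) (tsupport ψ) μ :=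
    (hw.integrableOn_compact_subset hψΩ hψc).mul_continuousOn hψ.continuousOn hψc
  exact (integrableOn_iff_integrable_of_support_subset fun y hy =>
    subset_tsupport ψ (right_ne_zero_of_mul hy)).1 h

theorem setIntegral_mul_of_tsupport_subset {X : Type*} [TopologicalSpace X] [MeasurableSpace X]
    {μ : Measure X} {Ω : Set X} (w : X → ℝ) {ψ : X → ℝ} (hψΩ : tsupport ψ ⊆ Ω) :
    ∫ x in Ω, w x * ψ x ∂μ = ∫ x, w x * ψ x ∂μ :=
  setIntegral_eq_integral_of_forall_compl_eq_zero fun x hx => by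
    rw [image_eq_zero_of_notMem_tsupport fun h => hx (hψΩ h), mul_zero]

theorem IsWeakPartialDeriv.ae_eq {Ω : Opens (Euc n)} {j : Fin n} {u g g' : Euc n → ℝ}
    (h : IsWeakPartialDeriv Ω j u g) (h' : IsWeakPartialDeriv Ω j u g') :
    g =ᵐ[volume.restrict (Ω : Set (Euc n))] g' := by
  have hae : ∀ᵐ x, x ∈ (Ω : Set (Euc n)) → (g - g') x = 0 := by
    refine Ω.isOpen.ae_eq_zero_of_integral_contDiff_smul_eq_zero (h.2.1.sub h'.2.1)
      fun φ hφ hφc hφΩ => ?_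
    let ψ : 𝓓(Ω, ℝ) := ⟨φ, hφ, hφc, hφΩ⟩
    calc ∫ x, φ x • (g - g') x = ∫ x, (g x * φ x - g' x * φ x) := by
          simp only [Pi.sub_apply, smul_eq_mul, mul_sub, mul_comm]
      _ = (∫ x in Ω, g x * ψ x) - ∫ x in Ω, g' x * ψ x := by
          rw [setIntegral_mul_of_tsupport_subset g ψ.tsupport_subset,
            setIntegral_mul_of_tsupport_subset g' ψ.tsupport_subset]
          exact integral_sub (integrable_mul_of_tsupport_subset h.2.1 hφ.continuous hφc hφΩ)
            (integrable_mul_of_tsupport_subset h'.2.1 hφ.continuous hφc hφΩ)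
      _ = 0 := sub_eq_zero.2 (neg_injective ((h.2.2 ψ).symm.trans (h'.2.2 ψ)))
  refine (ae_restrict_iff' Ω.isOpen.measurableSet).2 ?_
  filter_upwards [hae] with x hx hxΩ
  exact sub_eq_zero.1 (hx hxΩ)

theorem memLpLoc_of_isWeakJacobian {Ω : Opens (Euc n)} {p : ℝ≥0∞} {F : Euc n → Euc n}
    (hF : MemW1pLoc Ω p F) {DF : Euc n → Matrix (Fin n) (Fin n) ℝ} (hDF : IsWeakJacobian Ω F DF)
    (i j : Fin n) : MemLpLoc Ω p (fun x => DF x i j) := by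
  obtain ⟨-, DF', hDF', hp⟩ := hF
  intro K hK hKΩ
  exact (hp i j K hK hKΩ).ae_eq
    (ae_restrict_of_ae_restrict_of_subset hKΩ ((hDF' i j).ae_eq (hDF i j)))

theorem memLpLoc_jet {Ω : Opens (Euc n)} {p : ℝ≥0∞} {F : Euc n → Euc n} (hF : MemW1pLoc Ω p F)
    {DF : Euc n → Matrix (Fin n) (Fin n) ℝ} (hDF : IsWeakJacobian Ω F DF) :
    MemLpLoc Ω p (jet F DF) := fun K hK hKΩ =>
  memLp_prod_iff.2 ⟨hF.1 K hK hKΩ, memLp_pi_iff.2 fun j => memLp_piLp_iff.2 fun i =>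
    memLpLoc_of_isWeakJacobian hF hDF i j K hK hKΩ⟩

theorem convolution_indicator_jet {Ω : Opens (Euc n)} {F : Euc n → Euc n}
    {DF : Euc n → Matrix (Fin n) (Fin n) ℝ} (hDF : IsWeakJacobian Ω F DF) {K : Set (Euc n)}
    (hK : IsCompact K) (hKΩ : K ⊆ (Ω : Set (Euc n))) (hU : IntegrableOn (jet F DF) K)
    (ρ : ContDiffBump (0 : Euc n)) {x : Euc n} (hx : Metric.closedBall x ρ.rOut ⊆ K) :
    (ρ.normed volume ⋆[lsmul ℝ ℝ, volume] K.indicator (jet F DF)) x =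
      classicalJet (ρ.normed volume ⋆[lsmul ℝ ℝ, volume] K.indicator F) x := by
  have hUloc : LocallyIntegrable (K.indicator (jet F DF)) :=
    (hU.integrable_indicator hK.measurableSet).locallyIntegrable
  have hFloc : LocallyIntegrable (K.indicator F) :=
    (IntegrableOn.integrable_indicator hU.fst hK.measurableSet).locallyIntegrable
  refine Prod.ext (map_convolution_indicator (.fst ℝ (Euc n) (Fin n → Euc n)) ρ hUloc x) ?_
  ext j i
  let entry : Jet n →L[ℝ] ℝ := EuclideanSpace.proj i ∘L .proj j ∘L .snd ℝ (Euc n) (Fin n → Euc n)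
  calc ((ρ.normed volume ⋆[lsmul ℝ ℝ, volume] K.indicator (jet F DF)) x).2 j i
      = (ρ.normed volume ⋆[lsmul ℝ ℝ, volume] K.indicator fun y => DF y i j) x :=
        map_convolution_indicator entry ρ hUloc x
    _ = partialDeriv j (ρ.normed volume ⋆[lsmul ℝ ℝ, volume] K.indicator fun y => F y i) x :=
        ((hDF i j).partialDeriv_convolution hK hKΩ ρ hx).symm
    _ = partialDeriv j
          (fun z => (ρ.normed volume ⋆[lsmul ℝ ℝ, volume] K.indicator F) z i) x := by
        congr with z
        exact (map_convolution_indicator (EuclideanSpace.proj i) ρ hFloc z).symm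
    _ = (classicalJet (ρ.normed volume ⋆[lsmul ℝ ℝ, volume] K.indicator F) x).2 j i :=
        partialDeriv_apply
          ((contDiff_convolution_normed ρ hFloc (r := 1)).differentiable one_ne_zero x) i j

theorem integral_comp_mul_congr {X E : Type*} [TopologicalSpace X] [MeasurableSpace X]
    {μ : Measure X} (Φ : E → ℝ) {U U' : X → E} {ψ : X → ℝ} (h : ∀ x ∈ tsupport ψ, U x = U' x) :
    ∫ x, Φ (U x) * ψ x ∂μ = ∫ x, Φ (U' x) * ψ x ∂μ := by
  congr with x
  by_cases hx : x ∈ tsupport ψ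
  · rw [h x hx]
  · simp [image_eq_zero_of_notMem_tsupport hx]

theorem sum_integral_flux_convolution_jet {Ω : Opens (Euc n)} {F : Euc n → Euc n}
    {DF : Euc n → Matrix (Fin n) (Fin n) ℝ} (hDF : IsWeakJacobian Ω F DF) {K : Set (Euc n)}
    (hK : IsCompact K) (hKΩ : K ⊆ (Ω : Set (Euc n))) (hU : IntegrableOn (jet F DF) K)
    {V : Euc n → Euc n} (hV : ContDiff ℝ 1 V) {φ : Euc n → ℝ} (hφ : ContDiff ℝ 1 φ)
    (hφc : HasCompactSupport φ) (ρ : ContDiffBump (0 : Euc n))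
    (hρ : ∀ x ∈ tsupport φ, Metric.closedBall x ρ.rOut ⊆ K) :
    ∑ j, ∫ x, flux V j ((ρ.normed volume ⋆[lsmul ℝ ℝ, volume] K.indicator (jet F DF)) x) *
        partialDeriv j φ x =
      -∫ x, source V ((ρ.normed volume ⋆[lsmul ℝ ℝ, volume] K.indicator (jet F DF)) x) * φ x := by
  have hFloc : LocallyIntegrable (K.indicator F) :=
    (IntegrableOn.integrable_indicator hU.fst hK.measurableSet).locallyIntegrable
  have hjet := fun x hx => convolution_indicator_jet hDF hK hKΩ hU ρ (hρ x hx)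
  rw [integral_comp_mul_congr (source V) hjet, Finset.sum_congr rfl fun j _ =>
    integral_comp_mul_congr (flux V j) fun x hx => hjet x (tsupport_partialDeriv_subset j φ hx)]
  exact sum_integral_flux_classicalJet (contDiff_convolution_normed ρ hFloc (r := 2)) hV hφ hφc

theorem exists_seq_contDiffBump (X : Type*) [NormedAddCommGroup X] {δ : ℝ} (hδ : 0 < δ) :
    ∃ ρ : ℕ → ContDiffBump (0 : X), (∀ k, (ρ k).rOut ≤ δ) ∧
      (∀ k, (ρ k).rOut ≤ 2 * (ρ k).rIn) ∧ Tendsto (fun k => (ρ k).rOut) atTop (𝓝 0) := by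
  refine ⟨fun k => ⟨δ / (k + 1) / 2, δ / (k + 1), by positivity, half_lt_self (by positivity)⟩,
    fun k => div_le_self hδ.le (by simp), fun k => (mul_div_cancel₀ _ two_ne_zero).ge, ?_⟩
  simpa [div_eq_mul_inv] using (tendsto_one_div_add_atTop_nhds_zero_nat (𝕜 := ℝ)).const_mul δ

theorem tendsto_integral_comp_convolution_indicator {E : Type*} [NormedAddCommGroup E]
    [NormedSpace ℝ E] [CompleteSpace E] {m : ℕ} (hm : m ≠ 0) {U : Euc n → E} {K : Set (Euc n)}
    (hK : MeasurableSet K) (hU : MemLp U m (volume.restrict K)) {Φ : E → ℝ} (hΦ : Continuous Φ)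
    (hΦm : ∃ C : ℝ, ∀ p, |Φ p| ≤ C * (1 + ‖p‖ ^ m)) {ψ : Euc n → ℝ} (hψ : Continuous ψ)
    (hψc : HasCompactSupport ψ) (hψK : tsupport ψ ⊆ K) {ρ : ℕ → ContDiffBump (0 : Euc n)}
    (hρ : Tendsto (fun k => (ρ k).rOut) atTop (𝓝 0)) {a : ℝ}
    (hρa : ∀ k, (ρ k).rOut ≤ a * (ρ k).rIn) :
    Tendsto (fun k => ∫ x, Φ (((ρ k).normed volume ⋆[lsmul ℝ ℝ, volume] K.indicator U) x) * ψ x)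
      atTop (𝓝 (∫ x, Φ (U x) * ψ x)) := by
  have hUK : MemLp (K.indicator U) m volume := (memLp_indicator_iff_restrict hK).2 hU
  have hm₁ : (1 : ℝ≥0∞) ≤ m := by exact_mod_cast Nat.one_le_iff_ne_zero.2 hm
  rw [← integral_comp_mul_congr Φ fun x hx => Set.indicator_of_mem (hψK hx) U]
  exact tendsto_integral_comp_convolution_normed hΦ hΦm (hUK.locallyIntegrable hm₁)
    (hUK.integrable_norm_pow hm) (hψ.integrable_of_hasCompactSupport hψc)
    (hψc.exists_bound_of_continuous hψ) hρ hρa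

theorem sum_integral_flux_jet (hn : n ≠ 0) {Ω : Opens (Euc n)} {F : Euc n → Euc n}
    {DF : Euc n → Matrix (Fin n) (Fin n) ℝ} (hDF : IsWeakJacobian Ω F DF)
    (hjet : MemLpLoc Ω n (jet F DF)) {V : Euc n → Euc n} (hV : ContDiff ℝ 1 V)
    (hVb : ∃ C : ℝ, ∀ y, ‖V y‖ ≤ C * (1 + ‖y‖)) (hdiv : ∃ C : ℝ, ∀ y, |divergence V y| ≤ C)
    {φ : Euc n → ℝ} (hφ : ContDiff ℝ 1 φ) (hφc : HasCompactSupport φ)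
    (hφΩ : tsupport φ ⊆ (Ω : Set (Euc n))) :
    ∑ j, ∫ x, flux V j (jet F DF x) * partialDeriv j φ x =
      -∫ x, source V (jet F DF x) * φ x := by
  obtain ⟨δ, hδ, hKΩ⟩ := hφc.exists_cthickening_subset_open Ω.isOpen hφΩ
  let K : Set (Euc n) := Metric.cthickening δ (tsupport φ)
  have hK : IsCompact K := hφc.isCompact.cthickening
  have hφK : tsupport φ ⊆ K := Metric.self_subset_cthickening _
  have hjetK : MemLp (jet F DF) n (volume.restrict K) := hjet K hK hKΩ
  have hint : IntegrableOn (jet F DF) K :=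
    have : IsFiniteMeasure ((volume : Measure (Euc n)).restrict K) :=
      isFiniteMeasure_restrict.2 hK.measure_lt_top.ne
    hjetK.integrable (by exact_mod_cast Nat.one_le_iff_ne_zero.2 hn)
  obtain ⟨ρ, hρδ, hρ₂, hρ₀⟩ := exists_seq_contDiffBump (Euc n) hδ
  have hρK : ∀ k, ∀ x ∈ tsupport φ, Metric.closedBall x (ρ k).rOut ⊆ K := fun k x hx =>
    (Metric.closedBall_subset_cthickening hx _).trans (Metric.cthickening_mono (hρδ k) _)
  have hflux := tendsto_finsetSum Finset.univ fun (j : Fin n) _ =>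
    have hjφ : tsupport (partialDeriv j φ) ⊆ tsupport φ := tsupport_partialDeriv_subset j φ
    tendsto_integral_comp_convolution_indicator hn hK.measurableSet hjetK
      (contDiff_flux hV j).continuous (exists_abs_flux_le hVb j)
      ((hφ.continuous_fderiv one_ne_zero).clm_apply continuous_const)
      (hφc.of_isClosed_subset (isClosed_tsupport _) hjφ) (hjφ.trans hφK) hρ₀ hρ₂
  have hsource := tendsto_integral_comp_convolution_indicator hn hK.measurableSet hjetK
    (continuous_source hV) (exists_abs_source_le hdiv) hφ.continuous hφc hφK hρ₀ hρ₂
  exact tendsto_nhds_unique (hflux.congr fun k =>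
    sum_integral_flux_convolution_jet hDF hK hKΩ hint hV hφ hφc (ρ k) (hρK k)) hsource.neg

theorem MemLpLoc.locallyIntegrableOn_comp {E : Type*} [NormedAddCommGroup E] {Ω : Opens (Euc n)}
    {m : ℕ} (hm : m ≠ 0) {U : Euc n → E} (hU : MemLpLoc Ω m U) {Φ : E → ℝ} (hΦ : Continuous Φ)
    (hΦm : ∃ C : ℝ, ∀ p, |Φ p| ≤ C * (1 + ‖p‖ ^ m)) :
    LocallyIntegrableOn (fun x => Φ (U x)) (Ω : Set (Euc n)) := by
  obtain ⟨C, hC⟩ := hΦm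
  refine (locallyIntegrableOn_iff Ω.isOpen.isLocallyClosed).2 fun K hKΩ hK => ?_
  have hdom : IntegrableOn (fun x => C * (1 + ‖U x‖ ^ m)) K :=
    ((integrableOn_const hK.measure_lt_top.ne).add
      ((hU K hK hKΩ).integrable_norm_pow hm)).const_mul C
  exact hdom.mono' (hΦ.comp_aestronglyMeasurable (hU K hK hKΩ).aestronglyMeasurable)
    (.of_forall fun x => hC (U x))

theorem distribDivEq_of_sum_integral {Ω : Opens (Euc n)} {W : Euc n → Euc n} {g : Euc n → ℝ}
    (hW : ∀ j, LocallyIntegrableOn (fun x => W x j) (Ω : Set (Euc n)))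
    (hg : LocallyIntegrableOn g (Ω : Set (Euc n)))
    (h : ∀ φ : 𝓓(Ω, ℝ), ∑ j, ∫ x, W x j * partialDeriv j φ x = -∫ x, g x * φ x) :
    DistribDivEq Ω W g := by
  refine ⟨(locallyIntegrableOn_iff Ω.isOpen.isLocallyClosed).2 fun K hKΩ hK =>
    integrable_piLp_iff.2 fun j => (hW j).integrableOn_compact_subset hKΩ hK, hg, fun φ => ?_⟩
  have hφΩ : ∀ j, tsupport (partialDeriv j φ) ⊆ (Ω : Set (Euc n)) := fun j =>
    (tsupport_partialDeriv_subset j φ).trans φ.tsupport_subset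
  have hint : ∀ j, Integrable fun x => W x j * partialDeriv j φ x := fun j =>
    integrable_mul_of_tsupport_subset (hW j)
      ((φ.contDiff.continuous_fderiv (by simp)).clm_apply continuous_const)
      (φ.hasCompactSupport.of_isClosed_subset (isClosed_tsupport _)
        (tsupport_partialDeriv_subset j φ)) (hφΩ j)
  rw [integral_finsetSum _ fun j _ => (hint j).integrableOn,
    setIntegral_mul_of_tsupport_subset g φ.tsupport_subset, ← h φ]
  exact Finset.sum_congr rfl fun j _ => setIntegral_mul_of_tsupport_subset _ (hφΩ j)

end Piola

theorem theorem2p1_general (n : ℕ) (hn : n ≠ 0) (Ω : TopologicalSpace.Opens (Piola.Euc n))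
    (F : Piola.Euc n → Piola.Euc n) (hF : Piola.MemW1pLoc Ω (n : ENNReal) F)
    (DF : Piola.Euc n → Matrix (Fin n) (Fin n) ℝ) (hDF : Piola.IsWeakJacobian Ω F DF)
    (V : Piola.Euc n → Piola.Euc n) (hV : ContDiff ℝ 1 V)
    (hVb : ∃ C : ℝ, ∀ y, ‖V y‖ ≤ C * (1 + ‖y‖))
    (hdiv : ∃ C : ℝ, ∀ y, |Piola.divergence V y| ≤ C) :
    Piola.DistribDivEq Ω
      (fun x => WithLp.toLp 2 ((DF x).adjugate.mulVec (V (F x)).ofLp))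
      (fun x => Piola.divergence V (F x) * (DF x).det) := by
  have hjet : Piola.MemLpLoc Ω n (Piola.jet F DF) := Piola.memLpLoc_jet hF hDF
  have hflux := fun j => hjet.locallyIntegrableOn_comp hn (Piola.contDiff_flux hV j).continuous
    (Piola.exists_abs_flux_le hVb j)
  have hsource := hjet.locallyIntegrableOn_comp hn (Piola.continuous_source hV)
    (Piola.exists_abs_source_le hdiv)
  refine Piola.distribDivEq_of_sum_integral (fun j => ?_) hsource fun φ => ?_
  · simpa only [Piola.flux_jet] using hflux j
  · simpa only [Piola.flux_jet, Piola.source_jet] using Piola.sum_integral_flux_jet hn hDF hjet hV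
      hVb hdiv (φ.contDiff.of_le (by simp)) φ.hasCompactSupport φ.tsupport_subset

theorem theorem2p1 (n : ℕ) (hn : 2 ≤ n) (Ω : TopologicalSpace.Opens (Piola.Euc n))
    (F : Piola.Euc n → Piola.Euc n) (hF : Piola.MemW1pLoc Ω (n : ENNReal) F)
    (DF : Piola.Euc n → Matrix (Fin n) (Fin n) ℝ) (hDF : Piola.IsWeakJacobian Ω F DF)
    (V : Piola.Euc n → Piola.Euc n) (hV : ContDiff ℝ 1 V)
    (hV' : ∃ C : ℝ, ∀ y, ‖fderiv ℝ V y‖ ≤ C) :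
    Piola.DistribDivEq Ω
      (fun x => WithLp.toLp 2 ((DF x).adjugate.mulVec (V (F x)).ofLp))
      (fun x => Piola.divergence V (F x) * (DF x).det) :=
  have hV₁ : Differentiable ℝ V := hV.differentiable one_ne_zero
  theorem2p1_general n (by lia) Ω F hF DF hDF V hV (Piola.exists_norm_le_one_add_norm hV₁ hV')
    (Piola.exists_abs_divergence_le hV₁ hV')
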